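/- For a partition $\lambda$ of $n$ let $\chi^\lambda$ be the irreducible complex character of the symmetric group $\mathfrak S_n$ indexed by $\lambda$, and write $\chi^\lambda(\nu)$ for its value at permutations of cycle type $\nu$. For positive integers $p,q$ let $p\times q$ be the partition with $p$ parts, all equal to $q$. Fix an integer $k\ge 1$. There is a unique polynomial $F_k(p;q)$ in two variables with rational coefficients such that $$F_k(p;q)=\frac{n(n-1)\cdots(n-k+1)\,\chi^{p\times q}(k,1^{n-k})}{\chi^{p\times q}(1^n)},\qquad n=pq,$$ for all positive integers $p,q$ with $pq\ge k$. Let $G_k(p;q)$ be the sum of the terms of $F_k(p;q)$ of total degree $k+1$, and for $1\le i\le k$ let $N(k,i)=\frac1k\binom{k}{i}\binom{k}{i-1}$ (a Narayana number). Then $$(-1)^kG_k(p;-q)=\sum_{i=1}^kN(k,i)\,p^{k+1-i}q^i .$$ Let $\kappa(w)$ denote the number of cycles of a permutation $w$, fixed points included. For every $1\le i\le k$, the number $N(k,i)$ is equal to the number of pairs $(u,v)\in\mathfrak S_k\times\mathfrak S_k$ with $uv=(1,2,\dots,k)$, $\kappa(u)=i$ and $\kappa(v)=k+1-i$. Moreover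 $\sum_{i=1}^kN(k,i)$ is the $k$th Catalan number $C_k$, and $C_k$ is equal to the number of pairs $(u,v)\in\mathfrak S_k\times\mathfrak S_k$ with $uv=(1,2,\dots,k)$ and $\kappa(u)+\kappa(v)=k+1$. -/

import Mathlib

open scoped MonoidAlgebra

noncomputable section

namespace RectangularCharacters

/-- The Young symmetrizer `c_lam = a_lam * b_lam` in the complex group algebra of the group of
permutations of the `n` boxes of `lam`: `a_lam` is the sum of all permutations preserving every
row, and `b_lam` is the signed sum of all permutations preserving every column. -/
def youngSymmetrizer (lam : YoungDiagram) : ℂ[Equiv.Perm lam.cells] :=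
  (∑ w : Equiv.Perm lam.cells with ∀ b, (w b).1.1 = b.1.1, MonoidAlgebra.single w 1) *
    ∑ w : Equiv.Perm lam.cells with ∀ b, (w b).1.2 = b.1.2,
      MonoidAlgebra.single w ((Equiv.Perm.sign w : ℤ) : ℂ)

/-- The Specht module of shape `lam`: the left ideal of the group algebra generated by the Young
symmetrizer. -/
abbrev spechtModule (lam : YoungDiagram) :
    Submodule ℂ[Equiv.Perm lam.cells] ℂ[Equiv.Perm lam.cells] :=
  Submodule.span ℂ[Equiv.Perm lam.cells] {youngSymmetrizer lam}

/-- The irreducible complex representation of the symmetric group on the `n` boxes of `lam` that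
is indexed by the partition `lam` of `n`. -/
def spechtRep (lam : YoungDiagram) :
    Representation ℂ (Equiv.Perm lam.cells) (spechtModule lam) :=
  Representation.ofModule' (spechtModule lam)

/-- The irreducible character `χ^lam`. -/
def irrChar (lam : YoungDiagram) (w : Equiv.Perm lam.cells) : ℂ :=
  (spechtRep lam).character w

/-- The normalized character `(n)_k χ^lam(w) / χ^lam(1)`, where `n` is the number of boxes. -/
def normalizedChar (lam : YoungDiagram) (k : ℕ) (w : Equiv.Perm lam.cells) : ℂ :=
  (lam.card.descFactorial k : ℂ) * irrChar lam w / irrChar lam 1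

/-- The rectangular shape with `p` parts (rows), all equal to `q`. -/
def rectangle (p q : ℕ) : YoungDiagram where
  cells := Finset.range p ×ˢ Finset.range q
  isLowerSet := by
    intro a b hba ha
    simp only [Finset.mem_coe, Finset.mem_product, Finset.mem_range] at ha ⊢
    exact ⟨lt_of_le_of_lt hba.1 ha.1, lt_of_le_of_lt hba.2 ha.2⟩

/-- `F`, a polynomial in `p = X 0` and `q = X 1`, represents the values of the normalized
characters of rectangular shape `p × q` at the cycle type `(k, 1^(pq - k))`. -/
def RepresentsNormalizedChar (k : ℕ) (F : MvPolynomial (Fin 2) ℚ) : Prop :=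
  ∀ p q : ℕ, 1 ≤ p → 1 ≤ q → k ≤ p * q →
    ∀ w : Equiv.Perm (rectangle p q).cells,
      w.partition.parts = k ::ₘ Multiset.replicate (p * q - k) 1 →
        MvPolynomial.aeval ![(p : ℂ), (q : ℂ)] F = normalizedChar (rectangle p q) k w

/-- The terms of total degree `k + 1` of `F`. -/
def leadingTerms (k : ℕ) (F : MvPolynomial (Fin 2) ℚ) : MvPolynomial (Fin 2) ℚ :=
  MvPolynomial.homogeneousComponent (k + 1) F

/-- The number of cycles of a permutation, fixed points included. -/
def numCycles {k : ℕ} (w : Equiv.Perm (Fin k)) : ℕ :=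
  w.partition.parts.card

/-- The Narayana number `N(k,i) = (1/k) * C(k,i) * C(k,i-1)`, for `1 ≤ i ≤ k`. -/
def narayana (k i : ℕ) : ℚ :=
  1 / (k : ℚ) * (k.choose i : ℚ) * (k.choose (i - 1) : ℚ)

end RectangularCharacters

end

/-! Everything follows from the formula F_k(p;q) = ∑ (-1)^(k+κ(v)) p^κ(u) q^κ(v), summed over all
factorizations uv of a full cycle in S_k.

For a rectangle the Young symmetrizer c satisfies c * c = a • c, so a χ(w) is the trace of x ↦ w x c
on the whole group algebra, that is, a sum of coefficients of c at conjugates of w⁻¹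
(`normalizedChar_rectangle`). Averaging over conjugates amounts to placing a k-cycle on k distinct
boxes in all possible ways. The coefficient of c at such a placed cycle is a signed sum over
factorizations uv of the cycle with u preserving rows and v preserving columns
(`coeff_youngSymmetrizer_conj`). A sign-reversing involution lifts the condition that the boxes be
distinct (`placementSum_eq_zero`). Rows, constant on the cycles of u, and columns, constant on the
cycles of v, are then chosen independently (`sum_isCompatible`), which gives `normalizedChar_cycle`.

The terms of degree k + 1 come from the minimal factorizations, those with κ(u) + κ(v) = k + 1, and
the substitution q ↦ -q makes their signs uniform. To count them by κ(u), a dimension argument on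
invariant functions shows that u preserves the cycles of uv, so the generating polynomial is
multiplicative over disjoint cycles (`planarPoly_sumCongr`). Sorting by the image of one point under
u yields a quadratic recurrence (`planarPoly_finRotate_succ`), i.e. T = z(1 + T)(x + T) for the
generating series, and Lagrange inversion produces the Narayana numbers. Their sum is a Vandermonde
convolution. -/

noncomputable section

namespace RectangularCharacters

open Equiv Equiv.Perm

/-! ### Cycle counts and invariant functions -/

section CycleCount

variable {α β X : Type*}

/-- The number of orbits of a permutation. -/
def cycleCount (w : Perm α) : ℕ := Nat.card (Quotient (SameCycle.setoid w))

/-- The functions that are constant on the cycles of a permutation. -/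
abbrev InvariantFun (w : Perm α) (X : Type*) := {f : α → X // ∀ a, f (w a) = f a}

theorem apply_eq_of_sameCycle {w : Perm α} {f : α → X} (hf : ∀ a, f (w a) = f a) {x y : α}
    (h : w.SameCycle x y) : f x = f y := by
  obtain ⟨i, rfl⟩ := h
  have key : ∀ i : ℤ, ∀ a, f ((w ^ i) a) = f a := by
    intro i
    induction i using Int.induction_on with
    | zero => simp
    | succ i ih => intro a; rw [zpow_add_one, Perm.mul_apply, ih, hf]
    | pred i ih =>
      intro a
      rw [zpow_sub_one, Perm.mul_apply, ih, ← hf (w⁻¹ a)]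
      simp
  exact (key i x).symm

/-- Functions constant on the cycles of `w` are functions on the set of cycles. -/
def invariantFunEquiv (w : Perm α) (X : Type*) :
    InvariantFun w X ≃ (Quotient (SameCycle.setoid w) → X) where
  toFun f := Quotient.lift f.1 fun _ _ h => apply_eq_of_sameCycle f.2 h
  invFun g := ⟨fun a => g ⟦a⟧, fun a => congrArg g (Quotient.sound
    (show w.SameCycle (w a) a from sameCycle_apply_left.2 (SameCycle.refl _ _)))⟩
  left_inv f := by ext; rfl
  right_inv g := by
    ext q
    induction q using Quotient.inductionOn
    rfl

theorem card_invariantFun [Finite α] (w : Perm α) (X : Type*) :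
    Nat.card (InvariantFun w X) = Nat.card X ^ cycleCount w := by
  rw [Nat.card_congr (invariantFunEquiv w X), Nat.card_fun, cycleCount]

/-- Since 2^c determines c, cycle counts can be computed through bijections between sets of Boolean
invariant functions, without handling the cycles themselves. -/
theorem cycleCount_eq_of_card [Finite α] {w : Perm α} {c : ℕ}
    (h : Nat.card (InvariantFun w Bool) = 2 ^ c) : cycleCount w = c := by
  rw [card_invariantFun, Nat.card_eq_fintype_card, Fintype.card_bool] at h
  exact Nat.pow_right_injective le_rfl h

theorem cycleCount_congr [Finite α] [Finite β] {w : Perm α} {w' : Perm β}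
    (e : InvariantFun w Bool ≃ InvariantFun w' Bool) : cycleCount w = cycleCount w' := by
  apply cycleCount_eq_of_card
  rw [Nat.card_congr e, card_invariantFun, Nat.card_eq_fintype_card, Fintype.card_bool]

theorem cycleCount_inv [Finite α] (w : Perm α) : cycleCount w⁻¹ = cycleCount w :=
  cycleCount_congr (Equiv.subtypeEquivRight fun f =>
    ⟨fun h a => by simpa using (h (w a)).symm, fun h a => by simpa using (h (w⁻¹ a)).symm⟩)

theorem cycleCount_permCongr [Finite α] [Finite β] (e : α ≃ β) (w : Perm α) :
    cycleCount (e.permCongr w) = cycleCount w :=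
  cycleCount_congr ((Equiv.arrowCongr e (Equiv.refl Bool)).symm.subtypeEquiv fun f => by
    simp only [permCongr_apply, Equiv.arrowCongr_symm, Equiv.refl_symm, arrowCongr_apply,
      coe_refl, Function.comp_apply, id_eq, Equiv.symm_symm]
    exact ⟨fun h a => by simpa using h (e a), fun h a => by simpa using h (e.symm a)⟩)

theorem cycleCount_sumCongr [Finite α] [Finite β] (σ : Perm α) (τ : Perm β) :
    cycleCount (Perm.sumCongr σ τ) = cycleCount σ + cycleCount τ := by
  have e : InvariantFun (Perm.sumCongr σ τ) Bool ≃ InvariantFun σ Bool × InvariantFun τ Bool :=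
    { toFun := fun f => (⟨fun a => f.1 (Sum.inl a), fun a => f.2 (Sum.inl a)⟩,
        ⟨fun b => f.1 (Sum.inr b), fun b => f.2 (Sum.inr b)⟩)
      invFun := fun g => ⟨Sum.elim g.1.1 g.2.1, by
        rintro (a | b)
        · exact g.1.2 a
        · exact g.2.2 b⟩
      left_inv := fun f => by ext (a | b) <;> rfl
      right_inv := fun g => rfl }
  apply cycleCount_eq_of_card
  rw [Nat.card_congr e, Nat.card_prod, card_invariantFun, card_invariantFun,
    Nat.card_eq_fintype_card, Fintype.card_bool, pow_add]

theorem cycleCount_optionCongr [Finite α] (σ : Perm α) :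
    cycleCount (optionCongr σ : Perm (Option α)) = cycleCount σ + 1 := by
  have e : InvariantFun (optionCongr σ : Perm (Option α)) Bool ≃ InvariantFun σ Bool × Bool :=
    { toFun := fun f => (⟨fun a => f.1 (some a), fun a => f.2 (some a)⟩, f.1 none)
      invFun := fun g => ⟨fun o => o.elim g.2 g.1.1, by
        rintro (_ | a)
        · rfl
        · exact g.1.2 a⟩
      left_inv := fun f => by ext (_ | a) <;> rfl
      right_inv := fun g => rfl }
  apply cycleCount_eq_of_card
  rw [Nat.card_congr e, Nat.card_prod, card_invariantFun, Nat.card_eq_fintype_card,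
    Fintype.card_bool, pow_succ]

/-- The transposition splices `none` into the cycle of `i`: an invariant function has its value at
`none` forced to be the value at `some i`. -/
theorem cycleCount_swap_mul_optionCongr [Finite α] [DecidableEq α] (i : α) (σ : Perm α) :
    cycleCount (swap none (some i) * optionCongr σ : Perm (Option α)) = cycleCount σ := by
  have key : ∀ (f : Option α → Bool), f none = f (some i) → ∀ x, f (swap none (some i) x) = f x := by
    intro f hf x
    rcases eq_or_ne x none with rfl | h1
    · rw [swap_apply_left, hf]
    rcases eq_or_ne x (some i) with rfl | h2
    · rw [swap_apply_right, hf]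
    rw [swap_apply_of_ne_of_ne h1 h2]
  have hnone : ∀ f : InvariantFun (swap none (some i) * optionCongr σ : Perm (Option α)) Bool,
      f.1 none = f.1 (some i) := fun f => by
    have := f.2 none
    rwa [Perm.mul_apply, show (optionCongr σ) none = none from rfl, swap_apply_left, eq_comm] at this
  refine cycleCount_congr
    { toFun := fun f => ⟨fun a => f.1 (some a), fun a => ?_⟩
      invFun := fun g => ⟨fun o => o.elim (g.1 i) g.1, ?_⟩
      left_inv := fun f => ?_
      right_inv := fun g => rfl }
  · have := f.2 (some a)
    rwa [Perm.mul_apply, key f.1 (hnone f)] at this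
  · intro x
    refine (key (fun o => o.elim (g.1 i) g.1) rfl _).trans ?_
    rcases x with _ | a
    · rfl
    · exact g.2 a
  · ext (_ | a)
    · exact (hnone f).symm
    · rfl

theorem cycleCount_swap_mul_optionCongr_eq [Finite α] [DecidableEq α] (i : Option α)
    (σ : Perm α) : cycleCount (swap none i * optionCongr σ : Perm (Option α)) =
      cycleCount σ + if i = none then 1 else 0 := by
  rcases i with _ | i
  · rw [swap_self, if_pos rfl]
    exact cycleCount_optionCongr σ
  · simpa using cycleCount_swap_mul_optionCongr i σ

theorem cycleCount_optionCongr_mul_swap_eq [Finite α] [DecidableEq α] (i : Option α)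
    (σ : Perm α) : cycleCount (optionCongr σ * swap none i : Perm (Option α)) =
      cycleCount σ + if i = none then 1 else 0 := by
  rw [← cycleCount_inv, mul_inv_rev, swap_inv, ← cycleCount_inv σ]
  exact cycleCount_swap_mul_optionCongr_eq i σ⁻¹

theorem cycleCount_pos [Finite α] [Nonempty α] (w : Perm α) : 0 < cycleCount w :=
  have : Nonempty (Quotient (SameCycle.setoid w)) := Nonempty.map (fun a => ⟦a⟧) ‹Nonempty α›
  Nat.card_pos

theorem card_partition_parts [Fintype α] [DecidableEq α] (w : Perm α) :
    w.partition.parts.card = cycleCount w := by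
  have hne : ∀ c : {c // c ∈ w.cycleFactorsFinset}, ∃ a, c.1 a ≠ a := fun c =>
    let ⟨a, ha, _⟩ := (mem_cycleFactorsFinset_iff.1 c.2).1
    ⟨a, ha⟩
  choose a ha using hne
  have hw : ∀ c, w.cycleOf (a c) = c.1 := fun c =>
    (cycle_is_cycleOf (mem_support.2 (ha c)) c.2).symm
  have hwa : ∀ c, w (a c) ≠ a c := fun c h => by
    have := (cycleOf_eq_one_iff w).2 h
    rw [hw] at this
    exact ha c (by rw [this]; rfl)
  -- An orbit is either the support of a nontrivial cycle factor, represented by a point `a c` that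
  -- it moves, or a fixed point.
  let φ : {c // c ∈ w.cycleFactorsFinset} ⊕ {x // w x = x} → Quotient (SameCycle.setoid w) :=
    Sum.elim (fun c => ⟦a c⟧) fun x => ⟦x.1⟧
  have hφ : Function.Bijective φ := by
    constructor
    · rintro (c | x) (d | y) h
      · have h : w.SameCycle (a c) (a d) := Quotient.exact h
        have := h.cycleOf_eq
        rw [hw, hw] at this
        rw [Subtype.ext this]
      · have h : w.SameCycle (a c) y := Quotient.exact h
        exact absurd ((h.apply_eq_self_iff).2 y.2) (hwa c)
      · have h : w.SameCycle x (a d) := Quotient.exact h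
        exact absurd ((h.apply_eq_self_iff).1 x.2) (hwa d)
      · have h : w.SameCycle x y := Quotient.exact h
        rw [Subtype.ext (h.eq_of_left x.2)]
    · intro q
      induction q using Quotient.inductionOn with | _ x
      by_cases hx : w x = x
      · exact ⟨Sum.inr ⟨x, hx⟩, rfl⟩
      · have hc : w.cycleOf x ∈ w.cycleFactorsFinset :=
          cycleOf_mem_cycleFactorsFinset_iff.2 (mem_support.2 hx)
        refine ⟨Sum.inl ⟨_, hc⟩, Quotient.sound ?_⟩
        have h1 := hw ⟨_, hc⟩
        have h2 := ha ⟨_, hc⟩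
        by_contra hn
        have hn : ¬ w.SameCycle x (a ⟨_, hc⟩) := fun h => hn h.symm
        exact h2 (cycleOf_apply_of_not_sameCycle hn)
  rw [cycleCount, ← Nat.card_congr (Equiv.ofBijective φ hφ), parts_partition, Multiset.card_add,
    Multiset.card_replicate, ← sum_cycleType, ← card_fixedPoints, Nat.card_sum,
    Nat.card_eq_fintype_card, Fintype.card_coe, ← Nat.card_eq_fintype_card,
    cycleType_def, Multiset.card_map]
  rfl

theorem numCycles_eq_cycleCount {k : ℕ} (w : Perm (Fin k)) : numCycles w = cycleCount w :=
  card_partition_parts w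

theorem sign_eq_neg_one_pow_cycleCount [Fintype α] [DecidableEq α] (w : Perm α) :
    ((Perm.sign w : ℤ)) = (-1) ^ (Fintype.card α + cycleCount w) := by
  have h1 : w.support.card ≤ Fintype.card α := Finset.card_le_univ _
  rw [← card_partition_parts, parts_partition, Multiset.card_add, Multiset.card_replicate,
    sign_of_cycleType, sum_cycleType]
  push_cast
  rw [show Fintype.card α + (w.cycleType.card + (Fintype.card α - w.support.card)) =
    w.support.card + w.cycleType.card + 2 * (Fintype.card α - w.support.card) by omega,
    pow_add _ _ (2 * _), pow_mul]
  simp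

end CycleCount

/-! ### The absolute order -/

section Absolute

variable {α : Type*}

/-- The rational functions that are constant on the cycles of `w`. -/
def invariantSubmodule (w : Perm α) : Submodule ℚ (α → ℚ) where
  carrier := {f | ∀ a, f (w a) = f a}
  add_mem' hf hg a := by simp [hf a, hg a]
  zero_mem' a := rfl
  smul_mem' c f hf a := by simp [hf a]

theorem finrank_invariantSubmodule [Finite α] (w : Perm α) :
    Module.finrank ℚ (invariantSubmodule w) = cycleCount w := by
  let e : invariantSubmodule w ≃ₗ[ℚ] (Quotient (SameCycle.setoid w) → ℚ) :=
    { invariantFunEquiv w ℚ with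
      map_add' := fun f g => by
        ext q
        induction q using Quotient.inductionOn
        rfl
      map_smul' := fun c f => by
        ext q
        induction q using Quotient.inductionOn
        rfl }
  have := Fintype.ofFinite (Quotient (SameCycle.setoid w))
  rw [e.finrank_eq, Module.finrank_fintype_fun_eq_card, cycleCount, Nat.card_eq_fintype_card]

theorem inf_invariantSubmodule_le (u v : Perm α) :
    invariantSubmodule u ⊓ invariantSubmodule v ≤ invariantSubmodule (u * v) :=
  fun _ hf a => (hf.1 (v a)).trans (hf.2 a)

theorem cycleCount_add_le_finrank_inf [Fintype α] (u v : Perm α) :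
    cycleCount u + cycleCount v ≤ Fintype.card α +
      Module.finrank ℚ ↥(invariantSubmodule u ⊓ invariantSubmodule v) := by
  rw [← finrank_invariantSubmodule, ← finrank_invariantSubmodule,
    ← Submodule.finrank_sup_add_finrank_inf_eq]
  have := Submodule.finrank_le (invariantSubmodule u ⊔ invariantSubmodule v)
  rw [Module.finrank_fintype_fun_eq_card] at this
  omega

/-- κ is the dimension of the space of invariant functions, and functions invariant under both `u`
and `v` are invariant under `u * v`; the bound is the dimension formula for sum and intersection. -/
theorem cycleCount_add_le [Fintype α] (u v : Perm α) :
    cycleCount u + cycleCount v ≤ Fintype.card α + cycleCount (u * v) := by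
  have h1 := cycleCount_add_le_finrank_inf u v
  have h2 := Submodule.finrank_mono (inf_invariantSubmodule_le u v)
  rw [finrank_invariantSubmodule] at h2
  omega

/-- If `u` lies below `u * v` in the absolute order, then `u` preserves the cycles of `u * v`. -/
theorem invariantSubmodule_mul_le [Fintype α] {u v : Perm α}
    (h : cycleCount u + cycleCount v = Fintype.card α + cycleCount (u * v)) :
    invariantSubmodule (u * v) ≤ invariantSubmodule u := by
  have h1 := cycleCount_add_le_finrank_inf u v
  rw [← Submodule.eq_of_le_of_finrank_le (inf_invariantSubmodule_le u v)
    (by rw [finrank_invariantSubmodule]; omega)]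
  exact inf_le_left

end Absolute

/-! ### Generating polynomials of minimal factorizations -/

section Planar

open Polynomial

variable {α β : Type*} [Fintype α] [Fintype β]

/-- The factorization `w = u * (u⁻¹ * w)` is minimal. -/
def IsMinimal (u w : Perm α) : Prop :=
  cycleCount u + cycleCount (u⁻¹ * w) = Fintype.card α + cycleCount w

instance (u w : Perm α) : Decidable (IsMinimal u w) := inferInstanceAs (Decidable (_ = _))

/-- The indicator function of the left summand is invariant under the product, hence under `u` by
minimality, so `u` cannot mix the summands. -/
theorem IsMinimal.exists_sumCongr {σ : Perm α} {τ : Perm β} {u : Perm (α ⊕ β)}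
    (h : IsMinimal u (Perm.sumCongr σ τ)) :
    ∃ u₁ u₂, Perm.sumCongr u₁ u₂ = u := by
  have hu : u * (u⁻¹ * Perm.sumCongr σ τ) = Perm.sumCongr σ τ := mul_inv_cancel_left _ _
  have hle := invariantSubmodule_mul_le (u := u) (v := u⁻¹ * Perm.sumCongr σ τ) (by rw [hu]; exact h)
  rw [hu] at hle
  have hind : (Sum.elim (fun _ => 1) (fun _ => 0) : α ⊕ β → ℚ) ∈
      invariantSubmodule (Perm.sumCongr σ τ) := by
    rintro (a | b) <;> rfl
  obtain ⟨⟨u₁, u₂⟩, hu'⟩ := mem_sumCongrHom_range_of_perm_mapsTo_inl (σ := u) (by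
    rintro _ ⟨a, rfl⟩
    have := hle hind (Sum.inl a)
    rcases hx : u (Sum.inl a) with b | b
    · exact ⟨b, rfl⟩
    · rw [hx] at this
      simp at this)
  exact ⟨u₁, u₂, hu'⟩

/-- Two instances of `cycleCount_add_le` are added, and the sum is an equality exactly when both
are. -/
theorem isMinimal_sumCongr_iff {σ u : Perm α} {τ v : Perm β} :
    IsMinimal (Perm.sumCongr u v) (Perm.sumCongr σ τ) ↔ IsMinimal u σ ∧ IsMinimal v τ := by
  have h : (Perm.sumCongr u v)⁻¹ * Perm.sumCongr σ τ = Perm.sumCongr (u⁻¹ * σ) (v⁻¹ * τ) := by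
    rw [Perm.sumCongr_inv, Perm.sumCongr_mul]
  have h1 := cycleCount_add_le u (u⁻¹ * σ)
  have h2 := cycleCount_add_le v (v⁻¹ * τ)
  rw [mul_inv_cancel_left] at h1 h2
  simp only [IsMinimal, h, cycleCount_sumCongr, Fintype.card_sum]
  omega

variable [DecidableEq α] [DecidableEq β]

/-- The minimal factorizations `w = u * v`, counted by the number of cycles of `u`. -/
def planarPoly (w : Perm α) : ℚ[X] :=
  ∑ u : Perm α, if IsMinimal u w then X ^ cycleCount u else 0

theorem planarPoly_permCongr (e : α ≃ β) (w : Perm α) :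
    planarPoly (e.permCongr w) = planarPoly w := by
  symm
  refine Fintype.sum_equiv e.permCongr _ _ fun u => ?_
  have h : (e.permCongr u)⁻¹ * e.permCongr w = e.permCongr (u⁻¹ * w) := by
    rw [← Equiv.permCongrHom_coe, map_mul, map_inv]
  simp only [IsMinimal, h, cycleCount_permCongr, Fintype.card_congr e]

theorem planarPoly_sumCongr (σ : Perm α) (τ : Perm β) :
    planarPoly (Perm.sumCongr σ τ) = planarPoly σ * planarPoly τ := by
  rw [planarPoly, planarPoly, planarPoly, Finset.sum_mul_sum, ← Fintype.sum_prod_type'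
    (f := fun u v => (if IsMinimal u σ then X ^ cycleCount u else 0) *
      (if IsMinimal v τ then (X : ℚ[X]) ^ cycleCount v else 0))]
  symm
  refine Finset.sum_of_injOn (fun x => Perm.sumCongr x.1 x.2)
    (fun x _ y _ h => sumCongrHom_injective (a₁ := x) (a₂ := y) h) (fun _ _ => Finset.mem_univ _)
    (fun u _ hu => ?_) (fun x _ => ?_)
  · rw [if_neg]
    intro h
    obtain ⟨u₁, u₂, rfl⟩ := h.exists_sumCongr
    exact hu ⟨(u₁, u₂), by simp, rfl⟩
  · simp only [isMinimal_sumCongr_iff, cycleCount_sumCongr, pow_add]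
    by_cases h1 : IsMinimal x.1 σ <;> by_cases h2 : IsMinimal x.2 τ <;> simp [h1, h2]

/-- The factorizations `W = u * v` for which `u` maps `none` to `i`. -/
theorem planarPoly_option (W : Perm (Option α)) (w : Option α → Perm α)
    (hw : ∀ i, optionCongr (w i) = swap none i * W * swap none (W⁻¹ i)) :
    planarPoly W = ∑ i, ∑ u : Perm α,
      if cycleCount u + (if i = none then 1 else 0) +
          (cycleCount (u⁻¹ * w i) + if W⁻¹ i = none then 1 else 0) =
            Fintype.card α + 1 + cycleCount W
      then (X : ℚ[X]) ^ (cycleCount u + if i = none then 1 else 0) else 0 := by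
  rw [← Fintype.sum_prod_type', planarPoly]
  symm
  refine Fintype.sum_equiv decomposeOption.symm _ _ fun ⟨i, u⟩ => ?_
  have h : (swap none i * optionCongr u : Perm (Option α))⁻¹ * W =
      optionCongr (u⁻¹ * w i) * swap none (W⁻¹ i) := by
    have : (optionCongr (u⁻¹ * w i) : Perm (Option α)) =
      (optionCongr u : Perm (Option α))⁻¹ * optionCongr (w i) := by
      ext (_ | x) <;> rfl
    rw [this, hw, mul_inv_rev, swap_inv, mul_assoc, mul_assoc, mul_assoc, mul_assoc,
      swap_mul_self, mul_one]
  simp only [decomposeOption_symm_apply, IsMinimal, h, cycleCount_swap_mul_optionCongr_eq,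
    cycleCount_optionCongr_mul_swap_eq, Fintype.card_option]

end Planar

/-! ### The factorizations of a full cycle -/

section FullCycle

open Polynomial

theorem partition_parts_finRotate {k : ℕ} (hk : 1 ≤ k) : (finRotate k).partition.parts = {k} := by
  rw [parts_partition]
  obtain rfl | hk := hk.eq_or_lt
  · rw [Subsingleton.elim (finRotate 1) 1]
    simp
  · rw [cycleType_finRotate_of_le hk, support_finRotate_of_le hk]
    simp

theorem cycleCount_finRotate {k : ℕ} (hk : 1 ≤ k) : cycleCount (finRotate k) = 1 := by
  rw [← card_partition_parts, partition_parts_finRotate hk, Multiset.card_singleton]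

theorem planarPoly_finRotate_one : planarPoly (finRotate 1) = X := by
  have h : ∀ u : Perm (Fin 1), cycleCount u = 1 := fun u => by
    rw [Subsingleton.elim u (finRotate 1), cycleCount_finRotate le_rfl]
  rw [planarPoly, Fintype.sum_unique]
  simp [IsMinimal, h]

theorem coe_finRotate_eq {n : ℕ} (x : Fin n) :
    (finRotate n x : ℕ) = if (x : ℕ) + 1 = n then 0 else (x : ℕ) + 1 := by
  obtain _ | n := n
  · exact x.elim0
  · rw [coe_finRotate]
    simp only [Fin.ext_iff, Fin.val_last, Nat.add_right_cancel_iff]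

/-- The full cycle on `Fin (n + 2)`, in which `none` plays the role of `0`. -/
def optionRotate (n : ℕ) : Perm (Option (Fin (n + 1))) :=
  swap none (some 0) * optionCongr (finRotate (n + 1))

theorem optionRotate_eq (n : ℕ) :
    optionRotate n = (finSuccEquiv (n + 1)).permCongr (finRotate (n + 2)) := by
  have h := finRotate_succ_eq_decomposeFin (n := n + 1)
  rw [show finRotate (n + 2) = finRotate (n + 1).succ from rfl, h, optionRotate]
  ext1 x
  have h1 : finSuccEquiv (n + 1) 1 = some 0 := finSuccEquiv_succ 0
  simp [decomposeFin, permCongr_apply, h1]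

theorem optionRotate_none (n : ℕ) : optionRotate n none = some 0 := by
  simp [optionRotate]

theorem optionRotate_split (n : ℕ) (i : Option (Fin (n + 1))) :
    optionCongr (i.elim 1 (fun i => swap 0 i) * finRotate (n + 1)) =
      swap none i * optionRotate n * swap none ((optionRotate n)⁻¹ i) := by
  rw [mul_assoc, mul_swap_eq_swap_mul,
    show optionRotate n ((optionRotate n)⁻¹ i) = i from apply_symm_apply _ _,
    optionRotate_none, optionRotate,
    ← mul_assoc, ← mul_assoc]
  have h : ∀ σ τ : Perm (Fin (n + 1)), (optionCongr (σ * τ) : Perm (Option (Fin (n + 1)))) =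
      optionCongr σ * optionCongr τ := fun σ τ => by ext (_ | x) <;> rfl
  rw [h]
  congr 1
  rcases i with _ | i
  · ext1 x
    simp [swap_comm]
  · rw [Option.elim_some, optionCongr_swap]
    ext1 x
    rcases x with _ | x <;> simp [Perm.mul_apply, swap_apply_def]
    all_goals split_ifs <;> simp_all

/-- The product of two full cycles on consecutive intervals. -/
def splitRotate {m a b : ℕ} (h : a + b = m) : Perm (Fin m) :=
  (finSumFinEquiv.trans (finCongr h)).permCongr (Perm.sumCongr (finRotate a) (finRotate b))

theorem planarPoly_splitRotate {m a b : ℕ} (h : a + b = m) :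
    planarPoly (splitRotate h) = planarPoly (finRotate a) * planarPoly (finRotate b) := by
  rw [splitRotate, planarPoly_permCongr, planarPoly_sumCongr]

theorem cycleCount_splitRotate {m a b : ℕ} (h : a + b = m) (ha : 1 ≤ a) (hb : 1 ≤ b) :
    cycleCount (splitRotate h) = 2 := by
  rw [splitRotate, cycleCount_permCongr, cycleCount_sumCongr, cycleCount_finRotate ha,
    cycleCount_finRotate hb]

theorem coe_splitRotate {m a b : ℕ} (h : a + b = m) (x : Fin m) :
    (splitRotate h x : ℕ) = if (x : ℕ) + 1 = a then 0 else if (x : ℕ) + 1 = m then a else x + 1 := by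
  obtain ⟨y, rfl⟩ := (finSumFinEquiv.trans (finCongr h)).surjective x
  subst h
  rcases y with y | y
  · obtain _ | a := a
    · exact y.elim0
    · have := y.2
      simp [splitRotate, permCongr_apply, coe_finRotate_eq, -finRotate_apply]
      split_ifs <;> omega
  · obtain _ | b := b
    · exact y.elim0
    · have := y.2
      simp [splitRotate, permCongr_apply, coe_finRotate_eq, -finRotate_apply]
      split_ifs <;> omega

/-- A transposition of two points of a full cycle cuts it into two cycles, here on consecutive
intervals. -/
theorem splitRotate_eq {n : ℕ} (a : Fin n) :
    swap 0 a.succ * finRotate (n + 1) =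
      splitRotate (show (a + 1 : ℕ) + (n - a) = n + 1 by omega) := by
  ext x
  rw [coe_splitRotate, Perm.mul_apply, swap_apply_def]
  have h := coe_finRotate_eq x
  generalize finRotate (n + 1) x = y at h ⊢
  have := a.2
  have := x.2
  simp only [Fin.ext_iff, apply_ite (Fin.val), Fin.val_zero, Fin.val_succ]
  split_ifs at h ⊢ <;> omega

/-- The first-return decomposition of the minimal factorizations of a full cycle. -/
theorem planarPoly_finRotate_succ (n : ℕ) :
    planarPoly (finRotate (n + 2)) = (X + 1) * planarPoly (finRotate (n + 1)) +
      ∑ a ∈ Finset.range n, planarPoly (finRotate (a + 1)) * planarPoly (finRotate (n - a)) := by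
  have hc : cycleCount (optionRotate n) = 1 := by
    rw [optionRotate_eq, cycleCount_permCongr, cycleCount_finRotate (by omega)]
  have hinv : ∀ i, (optionRotate n)⁻¹ i = none ↔ i = some 0 := fun i => by
    rw [Perm.inv_eq_iff_eq, optionRotate_none]
  rw [← planarPoly_permCongr (finSuccEquiv (n + 1)), ← optionRotate_eq,
    planarPoly_option _ _ (optionRotate_split n), Fintype.sum_option, Fin.sum_univ_succ,
    ← Fin.sum_univ_eq_sum_range
      (fun a => planarPoly (finRotate (a + 1)) * planarPoly (finRotate (n - a))), ← add_assoc]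
  -- The index `i` is the image of `none` under the first factor. For `i = none` that factor fixes
  -- `none`, giving the factor `X`; for `i = some 0` the second factor fixes `none`; any other `i`
  -- cuts the remaining cycle in two.
  simp only [hinv, hc]
  congr 1
  · rw [add_mul, one_mul, planarPoly, Finset.mul_sum]
    congr 1
    · refine Finset.sum_congr rfl fun u _ => ?_
      rw [mul_ite, mul_zero]
      refine if_congr ?_ (by simp [pow_succ']) rfl
      rw [IsMinimal, cycleCount_finRotate (by omega)]
      simp only [Option.elim_none, one_mul, if_true, reduceCtorEq, if_false]
      omega
    · refine Finset.sum_congr rfl fun u _ => if_congr ?_ (by simp) rfl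
      rw [IsMinimal, cycleCount_finRotate (by omega)]
      simp only [Option.elim_some, swap_self, if_true, reduceCtorEq, if_false]
      rw [show (Equiv.refl _ : Perm (Fin (n + 1))) = 1 from rfl, one_mul]
      omega
  · refine Finset.sum_congr rfl fun a _ => ?_
    rw [← planarPoly_splitRotate (show (a + 1 : ℕ) + (n - a) = n + 1 by omega), planarPoly]
    refine Finset.sum_congr rfl fun u _ => if_congr ?_ (by simp) rfl
    rw [IsMinimal, cycleCount_splitRotate _ (by omega) (by omega), Option.elim_some, splitRotate_eq]
    simp

end FullCycle

/-! ### Narayana numbers -/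

section Narayana

open Polynomial

/-- The coefficient of `t ^ s` in `((1 + t) * (x + t)) ^ k`. -/
def trinomialCoeff {R : Type*} [CommRing R] (x : R) : ℕ → ℤ → R
  | 0, s => if s = 0 then 1 else 0
  | k + 1, s => x * trinomialCoeff x k s + (1 + x) * trinomialCoeff x k (s - 1) +
      trinomialCoeff x k (s - 2)

/-- The relation between the coefficients of a power and those of its derivative. -/
theorem mul_trinomialCoeff_succ {R : Type*} [CommRing R] (x : R) (k : ℕ) (s : ℤ) :
    (s : R) * trinomialCoeff x (k + 1) s =
      (k + 1) * ((1 + x) * trinomialCoeff x k (s - 1) + 2 * trinomialCoeff x k (s - 2)) := by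
  induction k generalizing s with
  | zero =>
    simp only [trinomialCoeff, sub_eq_zero]
    by_cases h0 : s = 0
    · simp [h0]
    by_cases h1 : s = 1
    · simp [h1]
    by_cases h2 : s = 2
    · simp [h2]
    simp [h0, h1, h2]
  | succ k ih =>
    have e0 := ih s
    have e1 := ih (s - 1)
    have e2 := ih (s - 2)
    rw [trinomialCoeff]
    have f1 : trinomialCoeff x (k + 1) (s - 1) = x * trinomialCoeff x k (s - 1) +
      (1 + x) * trinomialCoeff x k (s - 1 - 1) + trinomialCoeff x k (s - 1 - 2) := rfl
    have f2 : trinomialCoeff x (k + 1) (s - 2) = x * trinomialCoeff x k (s - 2) +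
      (1 + x) * trinomialCoeff x k (s - 2 - 1) + trinomialCoeff x k (s - 2 - 2) := rfl
    have g1 : s - 1 - 1 = s - 2 := by ring
    have g2 : s - 1 - 2 = s - 2 - 1 := by ring
    rw [g1, g2] at e1 f1
    push_cast at e0 e1 e2 ⊢
    linear_combination x * e0 + (1 + x) * e1 + e2 - (k + 1) * (1 + x) * f1 - 2 * (k + 1) * f2

/-- The binomial coefficient `k.choose s`, which vanishes for negative `s`. -/
def intChoose (k : ℕ) (s : ℤ) : ℚ := if 0 ≤ s then k.choose s.toNat else 0

theorem intChoose_natCast (k s : ℕ) : intChoose k s = k.choose s := by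
  simp [intChoose]

theorem intChoose_succ (k : ℕ) (s : ℤ) :
    intChoose (k + 1) s = intChoose k s + intChoose k (s - 1) := by
  rcases s with (_ | s) | s
  · simp [intChoose]
  · have h : (Int.ofNat (s + 1)) - 1 = (s : ℤ) := by simp
    rw [h]
    simp only [Int.ofNat_eq_natCast, intChoose_natCast, Nat.choose_succ_succ]
    push_cast
    ring
  · have h1 : ¬ (0 : ℤ) ≤ Int.negSucc s := by simp
    simp [intChoose, h1]

/-- In `(1 + t)^k * (x + t)^k`, taking `x` from `i` of the factors `x + t` contributes `t^(k - i)`,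
so `1 + t` must supply `t^(s - k + i)`. -/
theorem coeff_trinomialCoeff (k : ℕ) (s : ℤ) (i : ℕ) :
    (trinomialCoeff (X : ℚ[X]) k s).coeff i = k.choose i * intChoose k (s - k + i) := by
  induction k generalizing s i with
  | zero =>
    rcases i with _ | i
    · by_cases hs : s = 0
      · simp [trinomialCoeff, intChoose, hs]
      · rw [trinomialCoeff, if_neg hs, intChoose]
        split_ifs with h
        · have h' : 0 < (s - (0 : ℕ) + (0 : ℕ)).toNat := by omega
          rw [Nat.choose_eq_zero_of_lt h']
          simp
        · simp
    · rw [trinomialCoeff]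
      split_ifs <;> simp [coeff_one]
  | succ k ih =>
    rw [trinomialCoeff, add_mul, one_mul]
    rcases i with _ | i
    · simp only [coeff_add, mul_coeff_zero, coeff_X_zero, zero_mul, zero_add, add_zero, ih,
        intChoose_succ]
      simp
      ring_nf
    · simp only [coeff_add, coeff_X_mul, ih, intChoose_succ, Nat.choose_succ_succ']
      push_cast
      ring_nf

variable {R : Type*} [CommRing R]

theorem coeff_succ_pow_succ {x : R} {T : PowerSeries R}
    (hT : T = PowerSeries.X * (PowerSeries.C x + PowerSeries.C (1 + x) * T + T ^ 2)) (k r : ℕ) :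
    PowerSeries.coeff (k + 1) (T ^ (r + 1)) = x * PowerSeries.coeff k (T ^ r) +
      (1 + x) * PowerSeries.coeff k (T ^ (r + 1)) + PowerSeries.coeff k (T ^ (r + 2)) := by
  have h : T ^ (r + 1) = PowerSeries.X * (PowerSeries.C x * T ^ r +
      PowerSeries.C (1 + x) * T ^ (r + 1) + T ^ (r + 2)) := by
    rw [pow_succ, mul_comm]
    nth_rw 1 [hT]
    ring
  nth_rw 1 [h]
  rw [PowerSeries.coeff_succ_X_mul, map_add, map_add, PowerSeries.coeff_C_mul,
    PowerSeries.coeff_C_mul]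

/-- Lagrange inversion for the series `T` with `T = z * (1 + T) * (x + T)`. -/
theorem natCast_mul_coeff_pow [IsDomain R] [CharZero R] {x : R} {T : PowerSeries R}
    (hT : T = PowerSeries.X * (PowerSeries.C x + PowerSeries.C (1 + x) * T + T ^ 2)) (k r : ℕ) :
    k * PowerSeries.coeff k (T ^ r) = r * trinomialCoeff x k (k - r) := by
  have h0 : ∀ r, PowerSeries.coeff 0 (T ^ r) = if r = 0 then 1 else 0 := fun r => by
    have : PowerSeries.constantCoeff T = 0 := by
      rw [hT]
      simp
    rw [PowerSeries.coeff_zero_eq_constantCoeff_apply, map_pow, this, zero_pow_eq]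
  induction k generalizing r with
  | zero =>
    by_cases hr : r = 0
    · simp [hr]
    · simp [trinomialCoeff, hr]
  | succ k ih =>
    rcases r with _ | r
    · rw [pow_zero, PowerSeries.coeff_one]
      simp
    rw [coeff_succ_pow_succ hT]
    -- The induction hypotheses determine the coefficients only after multiplication by `k`, so `k =
    -- 0` is treated apart.
    rcases Nat.eq_zero_or_pos k with rfl | hk
    · simp only [h0, trinomialCoeff]
      by_cases hr : r = 0
      · simp [hr]
      · have h1 : ¬ (-(r : ℤ) - 1 = 0) := by omega
        have h2 : ¬ (-(r : ℤ) - 2 = 0) := by omega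
        simp [hr, h1, h2]
    · have hk' : (k : R) ≠ 0 := by exact_mod_cast hk.ne'
      refine mul_left_cancel₀ hk' ?_
      have e0 := ih r
      have e1 := ih (r + 1)
      have e2 := ih (r + 2)
      -- The weights `r`, `r + 1`, `r + 2` of the hypotheses split into `r` times the recurrence `c`
      -- plus the derivative relation `d`, of total weight `(k + 1) * r + (k - r) = k * (r + 1)`.
      have d := mul_trinomialCoeff_succ x k (k - r)
      have c : trinomialCoeff x (k + 1) (k - r) = x * trinomialCoeff x k (k - r) +
        (1 + x) * trinomialCoeff x k (k - r - 1) + trinomialCoeff x k (k - r - 2) := rfl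
      have g0 : ((k + 1 : ℕ) : ℤ) - ((r + 1 : ℕ) : ℤ) = k - r := by push_cast; ring
      have g1 : (k : ℤ) - ((r + 1 : ℕ) : ℤ) = k - r - 1 := by push_cast; ring
      have g2 : (k : ℤ) - ((r + 2 : ℕ) : ℤ) = k - r - 2 := by push_cast; ring
      rw [g1] at e1
      rw [g2] at e2
      rw [g0]
      push_cast at e0 e1 e2 d ⊢
      linear_combination (k + 1) * x * e0 + (k + 1) * (1 + x) * e1 + (k + 1) * e2 - d -
        (k + 1) * (r : R) * c

/-- The generating series of the minimal factorizations of full cycles. -/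
def planarSeries : PowerSeries ℚ[X] :=
  PowerSeries.mk fun k => if k = 0 then 0 else planarPoly (finRotate k)

theorem planarSeries_eq : planarSeries =
    PowerSeries.X * (PowerSeries.C X + PowerSeries.C (1 + X) * planarSeries + planarSeries ^ 2) := by
  ext1 k
  rcases k with _ | k
  · simp [planarSeries]
  rw [PowerSeries.coeff_succ_X_mul, map_add, map_add, PowerSeries.coeff_C_mul, sq,
    PowerSeries.coeff_mul, Finset.Nat.sum_antidiagonal_eq_sum_range_succ_mk]
  rcases k with _ | n
  · simp [planarSeries, planarPoly_finRotate_one, -finRotate_one]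
  -- Both end terms of the convolution vanish because the series has no constant term.
  · rw [Finset.sum_range_succ, Finset.sum_range_succ']
    simp only [planarSeries, PowerSeries.coeff_mk, PowerSeries.coeff_C]
    simp only [Nat.add_eq_zero_iff, one_ne_zero, and_false, if_false, if_true, zero_mul, mul_zero,
      add_zero, zero_add, Nat.sub_self, planarPoly_finRotate_succ, add_comm (1 : ℚ[X])]
    congr 1
    refine Finset.sum_congr rfl fun a ha => ?_
    rw [Finset.mem_range] at ha
    rw [if_neg (by omega), show n + 1 - (a + 1) = n - a by omega]

theorem coeff_planarPoly_finRotate {k i : ℕ} (hk : 1 ≤ k) (hi : 1 ≤ i) :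
    (planarPoly (finRotate k)).coeff i = narayana k i := by
  have h := natCast_mul_coeff_pow planarSeries_eq k 1
  rw [pow_one, planarSeries, PowerSeries.coeff_mk, if_neg (by omega)] at h
  have h' := congrArg (fun P => coeff P i) h
  simp only [Nat.cast_one, one_mul, coeff_trinomialCoeff, coeff_natCast_mul] at h'
  rw [show (k : ℤ) - 1 - k + i = ((i - 1 : ℕ) : ℤ) by omega, intChoose_natCast] at h'
  have hk' : (k : ℚ) ≠ 0 := by exact_mod_cast (by omega : k ≠ 0)
  rw [narayana]
  field_simp
  linarith

theorem coeff_planarPoly {α : Type*} [Fintype α] [DecidableEq α] (w : Perm α) (i : ℕ) :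
    (planarPoly w).coeff i =
      (Finset.univ.filter fun u : Perm α => IsMinimal u w ∧ cycleCount u = i).card := by
  rw [planarPoly, finsetSum_coeff, Finset.card_filter]
  push_cast
  refine Finset.sum_congr rfl fun u _ => ?_
  by_cases h : IsMinimal u w <;> simp [h, coeff_X_pow, eq_comm]

/-- The factorizations of a full cycle with prescribed cycle counts. -/
theorem narayana_eq_card {k i : ℕ} (hi : i ∈ Finset.Icc 1 k) :
    narayana k i = (Finset.univ.filter fun u : Perm (Fin k) =>
      cycleCount u = i ∧ cycleCount (u⁻¹ * finRotate k) = k + 1 - i).card := by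
  rw [Finset.mem_Icc] at hi
  rw [← coeff_planarPoly_finRotate (hi.1.trans hi.2) hi.1, coeff_planarPoly]
  congr 2
  ext u
  simp only [Finset.mem_filter, Finset.mem_univ, true_and, IsMinimal,
    cycleCount_finRotate (hi.1.trans hi.2), Fintype.card_fin]
  omega

theorem narayana_symm {k i : ℕ} (hi : i ∈ Finset.Icc 1 k) :
    narayana k (k + 1 - i) = narayana k i := by
  rw [Finset.mem_Icc] at hi
  rw [narayana, narayana, show k + 1 - i - 1 = k - i by omega, Nat.choose_symm hi.2,
    show k + 1 - i = k - (i - 1) by omega, Nat.choose_symm (by omega)]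
  ring

theorem sum_narayana {k : ℕ} (hk : 1 ≤ k) :
    ∑ i ∈ Finset.Icc 1 k, narayana k i = (catalan k : ℚ) := by
  have h1 : ∑ i ∈ Finset.Icc 1 k, k.choose i * k.choose (i - 1) = (2 * k).choose (k + 1) := by
    rw [two_mul, Nat.add_choose_eq, Finset.Nat.sum_antidiagonal_eq_sum_range_succ_mk,
      Finset.sum_range_succ, Finset.sum_range_succ', Nat.choose_eq_zero_of_lt (k := k + 1) (by omega)]
    rw [← Finset.Ico_add_one_right_eq_Icc, Finset.sum_Ico_eq_sum_range]
    simp only [zero_mul, mul_zero, add_zero, Nat.add_sub_cancel, Nat.sub_zero, Nat.choose_succ_self]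
    refine Finset.sum_congr rfl fun i hi => ?_
    rw [Finset.mem_range] at hi
    rw [add_comm 1 i, show k + 1 - (i + 1) = k - i by omega, Nat.choose_symm hi.le]
    simp
  have h2 : (2 * k).choose (k + 1) * (k + 1) = k.centralBinom * k := by
    rw [Nat.choose_succ_right_eq, Nat.centralBinom]
    congr 1
    omega
  have h3 : (k + 1) * catalan k = k.centralBinom := succ_mul_catalan_eq_centralBinom k
  have h4 : (k * catalan k) = (2 * k).choose (k + 1) := by
    apply Nat.eq_of_mul_eq_mul_right (Nat.succ_pos k)
    rw [Nat.succ_eq_add_one, h2, ← h3]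
    ring
  have hk' : (k : ℚ) ≠ 0 := by exact_mod_cast (by omega : k ≠ 0)
  apply mul_left_cancel₀ hk'
  rw [Finset.mul_sum]
  have h5 : ∀ i, (k : ℚ) * narayana k i = ((k.choose i * k.choose (i - 1) : ℕ) : ℚ) := fun i => by
    rw [narayana]
    push_cast
    field_simp
  simp only [h5]
  exact_mod_cast h1.trans h4.symm

end Narayana

/-! ### Characters of left ideals of a group algebra -/

section LeftIdeal

variable {G : Type*} [Group G] [Fintype G] [DecidableEq G]

theorem trace_mulRight_comp_mulLeft (c : ℂ[G]) (w : G) :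
    LinearMap.trace ℂ ℂ[G] (LinearMap.mulRight ℂ c ∘ₗ LinearMap.mulLeft ℂ (MonoidAlgebra.single w 1)) =
      ∑ g, c.coeff (g⁻¹ * w⁻¹ * g) := by
  rw [LinearMap.trace_eq_matrix_trace ℂ (MonoidAlgebra.basis G ℂ), Matrix.trace]
  refine Finset.sum_congr rfl fun g _ => ?_
  rw [Matrix.diag_apply, LinearMap.toMatrix_apply]
  simp [MonoidAlgebra.basis, MonoidAlgebra.single_mul_single, MonoidAlgebra.coeff_single_mul_apply]

/-- The map `x ↦ w * x * c` sends the whole algebra into the left ideal, so its trace can be taken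
there, where right multiplication by `c` is the scalar `a`. -/
theorem mul_character_span_singleton {c : ℂ[G]} {a : ℂ} (hc : c * c = a • c) (w : G) :
    a * (Representation.ofModule' (Submodule.span ℂ[G] {c}) : Representation ℂ G _).character w =
      ∑ g, c.coeff (g⁻¹ * w⁻¹ * g) := by
  rw [← trace_mulRight_comp_mulLeft]
  set φ := LinearMap.mulRight ℂ c ∘ₗ LinearMap.mulLeft ℂ (MonoidAlgebra.single w 1) with hφ
  let M : Submodule ℂ ℂ[G] := (Submodule.span ℂ[G] {c}).restrictScalars ℂ
  have hφx : ∀ x, φ x = MonoidAlgebra.single w 1 * x * c := fun x => by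
    rw [hφ, LinearMap.comp_apply, LinearMap.mulRight_apply, LinearMap.mulLeft_apply]
  have hmem : ∀ x, φ x ∈ M := fun x => by
    rw [hφx, Submodule.restrictScalars_mem]
    exact Submodule.mem_span_singleton.2 ⟨_, smul_eq_mul _ _⟩
  have : Module.Finite ℂ ℂ[G] := Module.Finite.of_basis (MonoidAlgebra.basis G ℂ)
  have : Module.Free ℂ ℂ[G] := Module.Free.of_basis (MonoidAlgebra.basis G ℂ)
  rw [← LinearMap.trace_restrict_eq_of_forall_mem M φ hmem, Representation.character,
    ← smul_eq_mul, ← map_smul]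
  congr 1
  ext1 ⟨x, hx⟩
  obtain ⟨y, rfl⟩ := Submodule.mem_span_singleton.1 hx
  apply Subtype.ext
  change a • (MonoidAlgebra.single w 1 * (y * c)) = φ (y * c)
  rw [hφx, mul_assoc, mul_assoc, hc, mul_smul_comm, mul_smul_comm]

end LeftIdeal

/-! ### The Young symmetrizer of a rectangle -/

section Symmetrizer

/-- The permutation `w` preserves every row. -/
abbrev RowPreserving {lam : YoungDiagram} (w : Perm lam.cells) : Prop :=
  ∀ b, (w b).1.1 = b.1.1

/-- The permutation `w` preserves every column. -/
abbrev ColPreserving {lam : YoungDiagram} (w : Perm lam.cells) : Prop :=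
  ∀ b, (w b).1.2 = b.1.2

variable {lam : YoungDiagram}

theorem RowPreserving.mul {u v : Perm lam.cells} (hu : RowPreserving u) (hv : RowPreserving v) :
    RowPreserving (u * v) := fun b => (hu _).trans (hv b)

theorem ColPreserving.mul {u v : Perm lam.cells} (hu : ColPreserving u) (hv : ColPreserving v) :
    ColPreserving (u * v) := fun b => (hu _).trans (hv b)

theorem RowPreserving.inv {u : Perm lam.cells} (hu : RowPreserving u) : RowPreserving u⁻¹ :=
  fun b => by simpa using (hu (u⁻¹ b)).symm

theorem ColPreserving.inv {u : Perm lam.cells} (hu : ColPreserving u) : ColPreserving u⁻¹ :=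
  fun b => by simpa using (hu (u⁻¹ b)).symm

theorem eq_of_row_eq_of_col_eq {a b : lam.cells} (h1 : a.1.1 = b.1.1) (h2 : a.1.2 = b.1.2) :
    a = b := Subtype.ext (Prod.ext h1 h2)

theorem coeff_youngSymmetrizer (x : Perm lam.cells) :
    (youngSymmetrizer lam).coeff x = ∑ u : Perm lam.cells,
      if RowPreserving u ∧ ColPreserving (u⁻¹ * x) then ((sign (u⁻¹ * x) : ℤ) : ℂ) else 0 := by
  rw [youngSymmetrizer, Finset.sum_mul, MonoidAlgebra.coeff_sum, Finsupp.finsetSum_apply,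
    Finset.sum_filter]
  refine Finset.sum_congr rfl fun u _ => ?_
  rw [ite_and]
  refine if_congr Iff.rfl ?_ rfl
  rw [MonoidAlgebra.coeff_single_mul_apply, one_mul, MonoidAlgebra.coeff_sum,
    Finsupp.finsetSum_apply, Finset.sum_filter]
  rw [Finset.sum_eq_single (u⁻¹ * x)]
  · simp only [MonoidAlgebra.coeff_single, Finsupp.single_eq_same]
  · intro v _ hv
    simp [hv]
  · simp

theorem coeff_youngSymmetrizer_one : (youngSymmetrizer lam).coeff 1 = 1 := by
  rw [coeff_youngSymmetrizer, Finset.sum_eq_single 1]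
  · simp [RowPreserving, ColPreserving]
  · intro u _ hu
    rw [if_neg]
    rintro ⟨h1, h2⟩
    rw [mul_one] at h2
    refine hu (Perm.ext fun b => eq_of_row_eq_of_col_eq (h1 b) ?_)
    simpa using (h2 (u b)).symm
  · simp

/-- The elements of the group algebra that transform like the Young symmetrizer. -/
structure IsYoungEquivariant (z : ℂ[Perm lam.cells]) : Prop where
  row : ∀ u, RowPreserving u → ∀ x, z.coeff (u * x) = z.coeff x
  col : ∀ v, ColPreserving v → ∀ x, z.coeff (x * v) = ((sign v : ℤ) : ℂ) * z.coeff x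

theorem isYoungEquivariant_youngSymmetrizer : IsYoungEquivariant (youngSymmetrizer lam) where
  row u hu x := by
    rw [coeff_youngSymmetrizer, coeff_youngSymmetrizer]
    refine (Fintype.sum_equiv (Equiv.mulLeft u) _ _ fun v => ?_).symm
    simp only [Equiv.coe_mulLeft, mul_inv_rev, mul_assoc, inv_mul_cancel_left]
    refine if_congr (and_congr_left fun _ => ⟨hu.mul, fun h => ?_⟩) rfl rfl
    simpa using hu.inv.mul h
  col v hv x := by
    rw [coeff_youngSymmetrizer, coeff_youngSymmetrizer, Finset.mul_sum]
    refine Finset.sum_congr rfl fun u _ => ?_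
    rw [mul_ite, mul_zero, ← mul_assoc u⁻¹ x v]
    refine if_congr (and_congr_right fun _ => ⟨fun h => ?_, fun h => h.mul hv⟩) ?_ rfl
    · simpa using h.mul hv.inv
    · rw [Perm.sign_mul]
      push_cast
      ring

theorem IsYoungEquivariant.mul {y z : ℂ[Perm lam.cells]} (hy : IsYoungEquivariant y)
    (hz : IsYoungEquivariant z) : IsYoungEquivariant (y * z) where
  row u hu x := by
    have h : MonoidAlgebra.single u⁻¹ (1 : ℂ) * y = y := by
      ext g
      rw [MonoidAlgebra.coeff_single_mul_apply, one_mul, inv_inv, hy.row u hu]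
    conv_rhs => rw [← h, mul_assoc, MonoidAlgebra.coeff_single_mul_apply, one_mul, inv_inv]
  col v hv x := by
    have h : z * MonoidAlgebra.single v⁻¹ (1 : ℂ) = ((sign v : ℤ) : ℂ) • z := by
      ext g
      rw [MonoidAlgebra.coeff_mul_single_apply, mul_one, inv_inv, hz.col v hv]
      rfl
    have h2 := congrArg (fun z => (y * z).coeff x) h
    simp only [← mul_assoc, MonoidAlgebra.coeff_mul_single_apply, inv_inv, mul_one,
      mul_smul_comm, MonoidAlgebra.coeff_smul_apply, smul_eq_mul] at h2
    exact h2

/-- Moving the row transposition `swap a b` across `g` turns it into a column transposition, so the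
coefficient equals its own negative. -/
theorem IsYoungEquivariant.coeff_eq_zero {z : ℂ[Perm lam.cells]} (hz : IsYoungEquivariant z)
    {g : Perm lam.cells} {a b : lam.cells} (hab : a ≠ b) (h1 : a.1.1 = b.1.1)
    (h2 : (g⁻¹ a).1.2 = (g⁻¹ b).1.2) : z.coeff g = 0 := by
  have hr : RowPreserving (swap a b) := fun x => by
    rw [swap_apply_def]
    split_ifs <;> simp_all
  have hc : ColPreserving (swap (g⁻¹ a) (g⁻¹ b)) := fun x => by
    rw [swap_apply_def]
    split_ifs <;> simp_all
  have e1 := hz.row _ hr g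
  have e2 := hz.col _ hc g
  rw [mul_swap_eq_swap_mul, show g (g⁻¹ a) = a from apply_symm_apply _ _,
    show g (g⁻¹ b) = b from apply_symm_apply _ _, e1,
    sign_swap (fun h => hab (g⁻¹.injective h))] at e2
  push_cast at e2
  linear_combination e2 / 2

theorem row_lt {p q : ℕ} (b : (rectangle p q).cells) : b.1.1 < p := by
  have := b.2
  simp only [rectangle, Finset.mem_product, Finset.mem_range] at this
  exact this.1

theorem col_lt {p q : ℕ} (b : (rectangle p q).cells) : b.1.2 < q := by
  have := b.2
  simp only [rectangle, Finset.mem_product, Finset.mem_range] at this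
  exact this.2

/-- The box of a rectangle in a given row and a given column. -/
def box {p q : ℕ} (i j : ℕ) (hi : i < p) (hj : j < q) : (rectangle p q).cells :=
  ⟨(i, j), by simp [rectangle, hi, hj]⟩

theorem exists_rowPreserving_mul_colPreserving {p q : ℕ} {g : Perm (rectangle p q).cells}
    (hg : ∀ a b : (rectangle p q).cells, a.1.1 = b.1.1 → (g⁻¹ a).1.2 = (g⁻¹ b).1.2 → a = b) :
    ∃ u v, RowPreserving u ∧ ColPreserving v ∧ g = u * v := by
  -- Each box keeps its row and takes the column of its preimage under `g`. The target is always a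
  -- box because the shape is a rectangle, and `hg` is injectivity.
  let r : (rectangle p q).cells → (rectangle p q).cells := fun b =>
    box b.1.1 (g⁻¹ b).1.2 (row_lt b) (col_lt _)
  have hr : Function.Injective r := fun a b h =>
    hg a b (congrArg (fun x => x.1.1) h) (congrArg (fun x => x.1.2) h)
  let e : Perm (rectangle p q).cells := Equiv.ofBijective r (Finite.injective_iff_bijective.1 hr)
  have he : RowPreserving e := fun b => rfl
  refine ⟨e⁻¹, e * g, he.inv, fun b => ?_, (inv_mul_cancel_left e g).symm⟩
  change (g⁻¹ (g b)).1.2 = b.1.2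
  rw [show g⁻¹ (g b) = b from symm_apply_apply _ _]

theorem IsYoungEquivariant.eq_smul {p q : ℕ} {z : ℂ[Perm (rectangle p q).cells]}
    (hz : IsYoungEquivariant z) : z = z.coeff 1 • youngSymmetrizer (rectangle p q) := by
  have hc := isYoungEquivariant_youngSymmetrizer (lam := rectangle p q)
  ext g
  rw [MonoidAlgebra.coeff_smul_apply, smul_eq_mul]
  by_cases hg : ∀ a b : (rectangle p q).cells, a.1.1 = b.1.1 → (g⁻¹ a).1.2 = (g⁻¹ b).1.2 → a = b
  · obtain ⟨u, v, hu, hv, rfl⟩ := exists_rowPreserving_mul_colPreserving hg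
    have key : ∀ y : ℂ[Perm (rectangle p q).cells], IsYoungEquivariant y →
        y.coeff (u * v) = ((sign v : ℤ) : ℂ) * y.coeff 1 := fun y hy => by
      rw [hy.col v hv]
      congr 1
      simpa using hy.row u hu 1
    rw [key z hz, key _ hc, coeff_youngSymmetrizer_one]
    ring
  · push Not at hg
    obtain ⟨a, b, h1, h2, hab⟩ := hg
    rw [hz.coeff_eq_zero hab h1 h2, hc.coeff_eq_zero hab h1 h2, mul_zero]

/-- The normalized character of a rectangle as an average of the Young symmetrizer. -/
theorem normalizedChar_rectangle (p q k : ℕ) (w : Perm (rectangle p q).cells) :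
    normalizedChar (rectangle p q) k w = ((p * q).descFactorial k : ℂ) / ((p * q).factorial : ℂ) *
      ∑ g, (youngSymmetrizer (rectangle p q)).coeff (g * w⁻¹ * g⁻¹) := by
  have hcard : (rectangle p q).card = p * q := by
    change (Finset.range p ×ˢ Finset.range q).card = _
    simp
  have hcells : Fintype.card (rectangle p q).cells = p * q := by
    rw [Fintype.card_coe]
    exact hcard
  have hc := isYoungEquivariant_youngSymmetrizer (lam := rectangle p q)
  have key := mul_character_span_singleton (hc.mul hc).eq_smul
  set a := (youngSymmetrizer (rectangle p q) * youngSymmetrizer (rectangle p q)).coeff 1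
  have h1 : a * irrChar (rectangle p q) 1 = ((p * q).factorial : ℂ) := by
    refine (key 1).trans ?_
    simp [coeff_youngSymmetrizer_one, Fintype.card_perm, hcells]
  have h2 : a * irrChar (rectangle p q) w =
      ∑ g, (youngSymmetrizer (rectangle p q)).coeff (g * w⁻¹ * g⁻¹) := by
    refine (key w).trans (Fintype.sum_equiv (Equiv.inv _) _ _ fun g => ?_)
    simp
  have h3 : ((p * q).factorial : ℂ) ≠ 0 := by exact_mod_cast Nat.factorial_ne_zero _
  -- At `w = 1` the trace is `(p * q)!`, which shows that neither `a` nor the degree vanishes.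
  have ha : a ≠ 0 := fun h => h3 (by rw [← h1, h, zero_mul])
  have hχ : irrChar (rectangle p q) 1 ≠ 0 := fun h => h3 (by rw [← h1, h, mul_zero])
  rw [normalizedChar, hcard, ← h1, ← h2]
  field_simp

end Symmetrizer

/-! ### Extending permutations along an embedding -/

section Extend

variable {α β : Type*} [Fintype α] [Fintype β] [DecidableEq α] [DecidableEq β]

theorem sign_viaEmbedding (f : α ↪ β) (σ : Perm α) : sign (σ.viaEmbedding f) = sign σ := by
  let : DecidablePred (· ∈ Set.range f.1) := fun _ => Classical.propDecidable _
  exact sign_extendDomain σ _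

theorem cycleType_viaEmbedding (f : α ↪ β) (σ : Perm α) :
    (σ.viaEmbedding f).cycleType = σ.cycleType := by
  let : DecidablePred (· ∈ Set.range f.1) := fun _ => Classical.propDecidable _
  exact cycleType_extendDomain _

omit [Fintype β] [DecidableEq α] [DecidableEq β] in
theorem exists_viaEmbedding_eq (f : α ↪ β) {u : Perm β} (hu : ∀ b ∉ Set.range f, u b = b) :
    ∃ σ : Perm α, σ.viaEmbedding f = u := by
  have h : ∀ a, ∃ a', f a' = u (f a) := fun a => by
    by_contra hn
    exact hn ⟨a, (u.injective (hu _ hn)).symm⟩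
  choose s hs using h
  have hinj : Function.Injective s := fun a b hab =>
    f.injective (u.injective (by rw [← hs, ← hs, hab]))
  refine ⟨Equiv.ofBijective s (Finite.injective_iff_bijective.1 hinj), Perm.ext fun b => ?_⟩
  by_cases hb : b ∈ Set.range f
  · obtain ⟨a, rfl⟩ := hb
    rw [viaEmbedding_apply]
    exact hs a
  · rw [viaEmbedding_apply_of_notMem _ _ _ hb, hu b hb]

omit [DecidableEq α] [DecidableEq β] in
theorem exists_perm_comp_embedding (f g : α ↪ β) : ∃ h : Perm β, ∀ a, h (f a) = g a := by
  classical
  let e : {b // b ∈ Set.range f} ≃ {b // b ∈ Set.range g} :=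
    (Equiv.ofInjective f f.injective).symm.trans (Equiv.ofInjective g g.injective)
  refine ⟨e.extendSubtype, fun a => ?_⟩
  rw [Equiv.extendSubtype_apply_of_mem e _ ⟨a, rfl⟩]
  simp only [e, Equiv.trans_apply]
  rw [show (⟨f a, _⟩ : {b // b ∈ Set.range f}) = Equiv.ofInjective f f.injective a from rfl,
    Equiv.symm_apply_apply]
  rfl

omit [DecidableEq α] in
/-- Averaging over permutations amounts to averaging over embeddings. -/
theorem card_mul_sum_perm_eq {M : Type*} [CommSemiring M] (f : α ↪ β) (H : (α → β) → M) :
    (Fintype.card (α ↪ β) : M) * ∑ g : Perm β, H (g ∘ f) =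
      (Fintype.card (Perm β) : M) * ∑ f' : α ↪ β, H f' := by
  have h1 : ∀ f' : α ↪ β, ∑ g : Perm β, H (g ∘ f') = ∑ g : Perm β, H (g ∘ f) := fun f' => by
    obtain ⟨h, hh⟩ := exists_perm_comp_embedding f f'
    refine Fintype.sum_equiv (Equiv.mulRight h) _ _ fun g => congrArg H (funext fun a => ?_)
    simp [hh]
  have h2 : ∀ g : Perm β, ∑ f' : α ↪ β, H (g ∘ f') = ∑ f' : α ↪ β, H f' := fun g =>
    Fintype.sum_equiv ((Equiv.refl α).embeddingCongr g) _ _ fun f' => by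
      congr 1
  rw [← nsmul_eq_mul, ← nsmul_eq_mul, ← Finset.card_univ, ← Finset.card_univ,
    ← Finset.sum_const, ← Finset.sum_const]
  calc _ = ∑ f' : α ↪ β, ∑ g : Perm β, H (g ∘ f') := Finset.sum_congr rfl fun f' _ => (h1 f').symm
    _ = ∑ g : Perm β, ∑ f' : α ↪ β, H (g ∘ f') := Finset.sum_comm
    _ = _ := Finset.sum_congr rfl fun g _ => h2 g

end Extend

/-! ### Characters of rectangular shape as sums over factorizations -/

section Factorization

variable {k p q : ℕ}

/-- The placements `f` of `k` points in the rectangle contribute to the factorization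
`π = σ * (σ⁻¹ * π)` when rows are constant on the cycles of `σ` and columns are constant on the
cycles of `σ⁻¹ * π`. -/
def IsCompatible (π σ : Perm (Fin k)) (f : Fin k → (rectangle p q).cells) : Prop :=
  (∀ i, (f (σ i)).1.1 = (f i).1.1) ∧ ∀ i, (f ((σ⁻¹ * π) i)).1.2 = (f i).1.2

instance (π σ : Perm (Fin k)) (f : Fin k → (rectangle p q).cells) :
    Decidable (IsCompatible π σ f) := inferInstanceAs (Decidable (_ ∧ _))

/-- The signed count of the factorizations of `π` compatible with a placement. -/
def placementSum (π : Perm (Fin k)) (f : Fin k → (rectangle p q).cells) : ℂ :=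
  ∑ σ : Perm (Fin k), if IsCompatible π σ f then ((sign (σ⁻¹ * π) : ℤ) : ℂ) else 0

theorem coeff_youngSymmetrizer_conj (π : Perm (Fin k)) (f : Fin k ↪ (rectangle p q).cells)
    (g : Perm (rectangle p q).cells) :
    (youngSymmetrizer (rectangle p q)).coeff (g * π.viaEmbedding f * g⁻¹) =
      placementSum π (g ∘ f) := by
  have hrow : ∀ u : Perm (rectangle p q).cells, RowPreserving (g * u * g⁻¹) ↔
      ∀ b, (g (u b)).1.1 = (g b).1.1 := fun u =>
    ⟨fun h b => by simpa using h (g b), fun h b => by simpa using h (g⁻¹ b)⟩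
  have hcol : ∀ u : Perm (rectangle p q).cells, ColPreserving (g * u * g⁻¹) ↔
      ∀ b, (g (u b)).1.2 = (g b).1.2 := fun u =>
    ⟨fun h b => by simpa using h (g b), fun h b => by simpa using h (g⁻¹ b)⟩
  have hsign : ∀ u : Perm (rectangle p q).cells, sign (g * u * g⁻¹) = sign u := fun u => by
    rw [Perm.sign_mul, Perm.sign_mul, sign_inv, mul_comm, ← mul_assoc, Int.units_mul_self, one_mul]
  have hinv : ∀ σ : Perm (Fin k), (σ.viaEmbedding f)⁻¹ * π.viaEmbedding f =
      (σ⁻¹ * π).viaEmbedding f := fun σ => by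
    simp only [← viaEmbeddingHom_apply, map_mul, map_inv]
  have hext : ∀ (σ : Perm (Fin k)) (F : (rectangle p q).cells → ℕ),
      (∀ b, F (σ.viaEmbedding f b) = F b) ↔ ∀ i, F (f (σ i)) = F (f i) := fun σ F => by
    refine ⟨fun h i => by rw [← viaEmbedding_apply, h], fun h b => ?_⟩
    by_cases hb : b ∈ Set.range f
    · obtain ⟨i, rfl⟩ := hb
      rw [viaEmbedding_apply, h]
    · rw [viaEmbedding_apply_of_notMem _ _ _ hb]
  rw [coeff_youngSymmetrizer, ← Fintype.sum_equiv (MulAut.conj g).toEquiv (fun u => if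
      (∀ b, (g (u b)).1.1 = (g b).1.1) ∧ ∀ b, (g ((u⁻¹ * π.viaEmbedding f) b)).1.2 = (g b).1.2
      then ((sign (u⁻¹ * π.viaEmbedding f) : ℤ) : ℂ) else 0) _ fun u => ?_]
  · symm
    refine Finset.sum_of_injOn (fun σ => σ.viaEmbedding f)
      (fun σ _ τ _ h => viaEmbeddingHom_injective f h) (fun _ _ => Finset.mem_univ _)
      (fun u _ hu => if_neg ?_) fun σ _ => ?_
    · rintro ⟨h1, h2⟩
      apply hu
      -- Off the placed points the product is the identity: `b` and its image under the second
      -- factor share a column by `h2` and a row by `h1`, so they coincide.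
      have hfix : ∀ b ∉ Set.range f, u b = b := fun b hb => by
        have e : u ((u⁻¹ * π.viaEmbedding f) b) = b := by
          rw [← Perm.mul_apply, mul_inv_cancel_left, viaEmbedding_apply_of_notMem _ _ _ hb]
        have e2 : (u⁻¹ * π.viaEmbedding f) b = b := by
          refine g.injective (eq_of_row_eq_of_col_eq ?_ (h2 b))
          rw [← h1, e]
        rwa [e2] at e
      obtain ⟨σ, rfl⟩ := exists_viaEmbedding_eq f hfix
      exact ⟨σ, by simp, rfl⟩
    · rw [hinv, sign_viaEmbedding]
      refine if_congr (and_congr ?_ ?_) rfl rfl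
      · exact (hext σ fun b => (g b).1.1).symm
      · exact (hext _ fun b => (g b).1.2).symm
  · have e : (g * u * g⁻¹)⁻¹ * (g * π.viaEmbedding f * g⁻¹) =
        g * (u⁻¹ * π.viaEmbedding f) * g⁻¹ := by group
    simp only [MulEquiv.toEquiv_eq_coe, MulEquiv.coe_toEquiv, MulAut.conj_apply, e, hrow, hcol]
    rw [hsign]

/-- Placements with a repeated box do not contribute. -/
theorem placementSum_eq_zero (π : Perm (Fin k)) {f : Fin k → (rectangle p q).cells}
    (hf : ¬ Function.Injective f) : placementSum π f = 0 := by
  simp only [Function.Injective, not_forall] at hf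
  obtain ⟨i, j, hij, hne⟩ := hf
  have hs : ∀ x, f (swap i j x) = f x := fun x => by
    rw [swap_apply_def]
    split_ifs <;> simp_all
  -- If `f i = f j`, then `σ ↦ σ * swap i j` preserves compatibility and reverses the sign.
  have key : placementSum π f = - placementSum π f := by
    conv_rhs => rw [placementSum, ← Finset.sum_neg_distrib]
    refine Fintype.sum_equiv (Equiv.mulRight (swap i j)) _ _ fun σ => ?_
    have e : (σ * swap i j)⁻¹ * π = swap i j * (σ⁻¹ * π) := by
      rw [mul_inv_rev, swap_inv, mul_assoc]
    have hc : IsCompatible π (σ * swap i j) f ↔ IsCompatible π σ f := by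
      rw [IsCompatible, IsCompatible, e]
      refine and_congr ⟨fun h x => ?_, fun h x => ?_⟩ ?_
      · have := h (swap i j x)
        rwa [Perm.mul_apply, swap_apply_self, hs] at this
      · rw [Perm.mul_apply, h, hs]
      · simp only [Perm.mul_apply, hs]
    have hsign : sign (swap i j * (σ⁻¹ * π)) = -sign (σ⁻¹ * π) := by
      rw [Perm.sign_mul, sign_swap hne, neg_one_mul]
    rw [Equiv.coe_mulRight]
    simp only [hc, e, hsign]
    split_ifs <;> simp
  linear_combination key / 2

/-- In a rectangle every row meets every column, so a compatible placement is an independent choice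
of a row for each cycle of `σ` and a column for each cycle of `σ⁻¹ * π`. -/
theorem sum_isCompatible (π σ : Perm (Fin k)) :
    (∑ f : Fin k → (rectangle p q).cells, if IsCompatible π σ f then (1 : ℂ) else 0) =
      (p : ℂ) ^ cycleCount σ * (q : ℂ) ^ cycleCount (σ⁻¹ * π) := by
  have e : {f : Fin k → (rectangle p q).cells // IsCompatible π σ f} ≃
      InvariantFun σ (Fin p) × InvariantFun (σ⁻¹ * π) (Fin q) :=
    { toFun := fun f => (⟨fun i => ⟨(f.1 i).1.1, row_lt _⟩, fun i => Fin.ext (f.2.1 i)⟩,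
        ⟨fun i => ⟨(f.1 i).1.2, col_lt _⟩, fun i => Fin.ext (f.2.2 i)⟩)
      invFun := fun g => ⟨fun i => box (g.1.1 i) (g.2.1 i) (g.1.1 i).2 (g.2.1 i).2,
        fun i => congrArg Fin.val (g.1.2 i), fun i => congrArg Fin.val (g.2.2 i)⟩
      left_inv := fun f => rfl
      right_inv := fun g => rfl }
  rw [Finset.sum_boole, ← Fintype.card_subtype, ← Nat.card_eq_fintype_card, Nat.card_congr e,
    Nat.card_prod, card_invariantFun, card_invariantFun, Nat.card_eq_fintype_card,
    Nat.card_eq_fintype_card, Fintype.card_fin, Fintype.card_fin]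
  push_cast
  rfl

theorem sum_placementSum (π : Perm (Fin k)) :
    ∑ f : Fin k ↪ (rectangle p q).cells, placementSum π f = ∑ σ : Perm (Fin k),
      (-1) ^ (k + cycleCount (σ⁻¹ * π)) *
        ((p : ℂ) ^ cycleCount σ * (q : ℂ) ^ cycleCount (σ⁻¹ * π)) := by
  have h1 : ∑ f : Fin k ↪ (rectangle p q).cells, placementSum π f =
      ∑ f : Fin k → (rectangle p q).cells, placementSum π f :=
    Finset.sum_of_injOn (fun f : Fin k ↪ (rectangle p q).cells => (f : Fin k → _))
      (fun f _ g _ h => DFunLike.coe_injective h)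
      (fun _ _ => Finset.mem_univ _)
      (fun f _ hf => placementSum_eq_zero π fun hinj => hf ⟨⟨f, hinj⟩, by simp, rfl⟩)
      fun _ _ => rfl
  rw [h1]
  simp only [placementSum]
  rw [Finset.sum_comm]
  refine Finset.sum_congr rfl fun σ _ => ?_
  rw [← sum_isCompatible, Finset.mul_sum, sign_eq_neg_one_pow_cycleCount, Fintype.card_fin]
  refine Finset.sum_congr rfl fun f _ => ?_
  rw [mul_ite, mul_one, mul_zero]
  push_cast
  rfl

theorem card_cells_rectangle (p q : ℕ) : Fintype.card (rectangle p q).cells = p * q := by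
  rw [Fintype.card_coe, rectangle, Finset.card_product, Finset.card_range, Finset.card_range]

theorem normalizedChar_cycle (hk : 1 ≤ k) (hpq : k ≤ p * q) (w : Perm (rectangle p q).cells)
    (hw : w.partition.parts = k ::ₘ Multiset.replicate (p * q - k) 1) :
    normalizedChar (rectangle p q) k w = ∑ σ : Perm (Fin k),
      (-1) ^ (k + cycleCount (σ⁻¹ * finRotate k)) *
        ((p : ℂ) ^ cycleCount σ * (q : ℂ) ^ cycleCount (σ⁻¹ * finRotate k)) := by
  have hcard := card_cells_rectangle p q
  obtain ⟨f⟩ : Nonempty (Fin k ↪ (rectangle p q).cells) :=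
    Function.Embedding.nonempty_of_card_le (by rwa [Fintype.card_fin, hcard])
  -- Cycle types omit fixed points, so parts equal to 1 are filtered out on both sides; this also
  -- covers `k = 1`.
  have hct : w⁻¹.cycleType = ((finRotate k).viaEmbedding f).cycleType := by
    rw [cycleType_inv, cycleType_viaEmbedding, ← filter_parts_partition_eq_cycleType,
      ← filter_parts_partition_eq_cycleType, hw, partition_parts_finRotate hk,
      ← Multiset.cons_zero, Multiset.filter_cons, Multiset.filter_cons, Multiset.filter_zero,
      Multiset.filter_eq_nil.2]
    intro a ha
    rw [Multiset.eq_of_mem_replicate ha]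
    decide
  obtain ⟨h, hh⟩ := isConj_iff.1 (isConj_of_cycleType_eq hct).symm
  rw [normalizedChar_rectangle, ← hh]
  have h1 : ∑ g, (youngSymmetrizer (rectangle p q)).coeff
      (g * (h * (finRotate k).viaEmbedding f * h⁻¹) * g⁻¹) =
      ∑ g : Perm (rectangle p q).cells, placementSum (finRotate k) (g ∘ f) := by
    refine Fintype.sum_equiv (Equiv.mulRight h) _ _ fun g => ?_
    rw [Equiv.coe_mulRight, ← coeff_youngSymmetrizer_conj]
    refine congrArg _ ?_
    group
  have h2 := card_mul_sum_perm_eq f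
    (placementSum (finRotate k) : (Fin k → (rectangle p q).cells) → ℂ)
  -- The factor `(p * q).descFactorial k` of the normalized character is the number of embeddings.
  rw [Fintype.card_embedding_eq, Fintype.card_perm, hcard, Fintype.card_fin] at h2
  have h3 : ((p * q).factorial : ℂ) ≠ 0 := by exact_mod_cast Nat.factorial_ne_zero _
  rw [h1, div_mul_eq_mul_div, h2, mul_div_cancel_left₀ _ h3, sum_placementSum]

end Factorization

/-! ### The character polynomial of a rectangle -/

section CharacterPolynomial

variable {k : ℕ}

/-- The polynomial representing the normalized characters of rectangular shape at a `k`-cycle. -/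
def characterPoly (k : ℕ) : MvPolynomial (Fin 2) ℚ :=
  ∑ σ : Perm (Fin k), (-1) ^ (k + cycleCount (σ⁻¹ * finRotate k)) *
    (MvPolynomial.X 0 ^ cycleCount σ * MvPolynomial.X 1 ^ cycleCount (σ⁻¹ * finRotate k))

theorem representsNormalizedChar_characterPoly (hk : 1 ≤ k) :
    RepresentsNormalizedChar k (characterPoly k) := by
  intro p q _ _ hpq w hw
  rw [normalizedChar_cycle hk hpq w hw, characterPoly]
  simp

theorem exists_perm_rectangle {p q : ℕ} (hk : 1 ≤ k) (hpq : k ≤ p * q) :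
    ∃ w : Perm (rectangle p q).cells,
      w.partition.parts = k ::ₘ Multiset.replicate (p * q - k) 1 := by
  have hcard := card_cells_rectangle p q
  obtain ⟨f⟩ : Nonempty (Fin k ↪ (rectangle p q).cells) :=
    Function.Embedding.nonempty_of_card_le (by rwa [Fintype.card_fin, hcard])
  refine ⟨(finRotate k).viaEmbedding f, ?_⟩
  rw [parts_partition, ← sum_cycleType, cycleType_viaEmbedding, hcard]
  obtain rfl | hk := hk.eq_or_lt
  · rw [Subsingleton.elim (finRotate 1) 1, cycleType_one, Multiset.sum_zero, zero_add,
      ← Multiset.replicate_succ]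
    congr 1
    omega
  · rw [cycleType_finRotate_of_le hk, Multiset.sum_singleton]
    rfl

theorem RepresentsNormalizedChar.unique (hk : 1 ≤ k) {F G : MvPolynomial (Fin 2) ℚ}
    (hF : RepresentsNormalizedChar k F) (hG : RepresentsNormalizedChar k G) : F = G := by
  -- For `p, q ≥ k ≥ 1` the condition `k ≤ p * q` is automatic, so the two polynomials agree on a
  -- product of infinite sets.
  refine MvPolynomial.funext_set (fun _ => (Nat.cast : ℕ → ℚ) '' Set.Ici k)
    (fun _ => (Set.Ici_infinite k).image Nat.cast_injective.injOn) fun x hx => ?_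
  obtain ⟨p, hp, hxp⟩ := hx 0 trivial
  obtain ⟨q, hq, hxq⟩ := hx 1 trivial
  rw [Set.mem_Ici] at hp hq
  have hpq : k ≤ p * q := hp.trans (Nat.le_mul_of_pos_right p (by omega))
  obtain ⟨w, hw⟩ := exists_perm_rectangle hk hpq
  have h := (hF p q (by omega) (by omega) hpq w hw).trans
    (hG p q (by omega) (by omega) hpq w hw).symm
  have hx' : ![(p : ℂ), (q : ℂ)] = fun i => algebraMap ℚ ℂ (x i) := by
    ext i
    fin_cases i
    · simp [← hxp]
    · simp [← hxq]
  rw [hx'] at h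
  have key : ∀ P : MvPolynomial (Fin 2) ℚ,
      MvPolynomial.aeval (fun i => algebraMap ℚ ℂ (x i)) P =
        algebraMap ℚ ℂ (MvPolynomial.eval x P) := fun P => by
    exact (MvPolynomial.aeval_algebraMap_apply ℂ x P).trans (congrArg _
      (by rw [MvPolynomial.aeval_def, Algebra.algebraMap_self, MvPolynomial.eval₂_id]))
  rw [key, key] at h
  exact (algebraMap ℚ ℂ).injective h

theorem leadingTerms_characterPoly (k : ℕ) : leadingTerms k (characterPoly k) =
    ∑ σ : Perm (Fin k), if cycleCount σ + cycleCount (σ⁻¹ * finRotate k) = k + 1 then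
      (-1) ^ (k + cycleCount (σ⁻¹ * finRotate k)) *
        (MvPolynomial.X 0 ^ cycleCount σ * MvPolynomial.X 1 ^ cycleCount (σ⁻¹ * finRotate k))
      else 0 := by
  rw [leadingTerms, characterPoly, map_sum]
  refine Finset.sum_congr rfl fun σ _ => ?_
  have h : ((-1) ^ (k + cycleCount (σ⁻¹ * finRotate k)) *
      (MvPolynomial.X 0 ^ cycleCount σ * MvPolynomial.X 1 ^ cycleCount (σ⁻¹ * finRotate k)) :
        MvPolynomial (Fin 2) ℚ).IsHomogeneous
      (cycleCount σ + cycleCount (σ⁻¹ * finRotate k)) := by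
    have h1 : ((-1 : MvPolynomial (Fin 2) ℚ) ^ (k + cycleCount (σ⁻¹ * finRotate k))) =
        MvPolynomial.C ((-1) ^ (k + cycleCount (σ⁻¹ * finRotate k))) := by simp
    rw [h1]
    exact ((MvPolynomial.isHomogeneous_X_pow _ _).mul
      (MvPolynomial.isHomogeneous_X_pow _ _)).C_mul _
  rw [MvPolynomial.homogeneousComponent_of_mem h]
  exact if_congr eq_comm rfl rfl

theorem aeval_leadingTerms_characterPoly (hk : 1 ≤ k) :
    (-1) ^ k * MvPolynomial.aeval ![MvPolynomial.X 0, -MvPolynomial.X 1]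
        (leadingTerms k (characterPoly k)) =
      ∑ i ∈ Finset.Icc 1 k, MvPolynomial.C (narayana k i) *
        (MvPolynomial.X 0 : MvPolynomial (Fin 2) ℚ) ^ (k + 1 - i) * MvPolynomial.X 1 ^ i := by
  have : Nonempty (Fin k) := ⟨⟨0, hk⟩⟩
  have hterm : ∀ i ∈ Finset.Icc 1 k, MvPolynomial.C (narayana k i) *
      (MvPolynomial.X 0 : MvPolynomial (Fin 2) ℚ) ^ (k + 1 - i) * MvPolynomial.X 1 ^ i =
      ∑ σ : Perm (Fin k), if cycleCount σ = k + 1 - i ∧ cycleCount (σ⁻¹ * finRotate k) = i then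
        MvPolynomial.X 0 ^ (k + 1 - i) * MvPolynomial.X 1 ^ i else 0 := fun i hi => by
    have hi' := Finset.mem_Icc.1 hi
    -- The exponent of `q` counts the cycles of the second factor, whereas `narayana_eq_card`
    -- indexes by the first; the symmetry reconciles them.
    rw [← narayana_symm hi, narayana_eq_card (by rw [Finset.mem_Icc]; omega),
      show k + 1 - (k + 1 - i) = i by omega, ← Finset.sum_filter, Finset.sum_const, nsmul_eq_mul,
      map_natCast, mul_assoc]
  rw [Finset.sum_congr rfl hterm, Finset.sum_comm, leadingTerms_characterPoly, map_sum,
    Finset.mul_sum]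
  refine Finset.sum_congr rfl fun σ _ => ?_
  have h1 := cycleCount_pos σ
  have h2 := cycleCount_pos (σ⁻¹ * finRotate k)
  generalize cycleCount σ = a at *
  generalize cycleCount (σ⁻¹ * finRotate k) = b at *
  split_ifs with h
  · rw [Finset.sum_eq_single b, if_pos ⟨by omega, rfl⟩, show k + 1 - b = a by omega]
    · simp only [map_mul, map_pow, map_neg, map_one, MvPolynomial.aeval_X, Matrix.cons_val_zero,
        Matrix.cons_val_one]
      rw [neg_pow (MvPolynomial.X 1 : MvPolynomial (Fin 2) ℚ) b]
      have hs : ((-1 : MvPolynomial (Fin 2) ℚ)) ^ k * (-1) ^ (k + b) * (-1) ^ b = 1 := by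
        rw [← pow_add, ← pow_add]
        exact Even.neg_one_pow ⟨k + b, by ring⟩
      linear_combination (MvPolynomial.X 0 ^ a * MvPolynomial.X 1 ^ b) * hs
    · intro i _ hi
      exact if_neg fun hab => hi hab.2.symm
    · intro hb
      exact absurd (Finset.mem_Icc.2 ⟨h2, by omega⟩) hb
  · rw [map_zero, mul_zero, Finset.sum_eq_zero]
    intro i hi
    rw [Finset.mem_Icc] at hi
    exact if_neg fun hab => h (by omega)

/-- Factorizations of `c` are determined by their first factor. -/
theorem card_factorizations {G : Type*} [Group G] [Fintype G] (c : G) (P : G → G → Prop)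
    [DecidablePred fun u => P u (u⁻¹ * c)] :
    Nat.card {uv : G × G // uv.1 * uv.2 = c ∧ P uv.1 uv.2} =
      (Finset.univ.filter fun u => P u (u⁻¹ * c)).card := by
  have h : ∀ x : {uv : G × G // uv.1 * uv.2 = c ∧ P uv.1 uv.2}, x.1.1⁻¹ * c = x.1.2 := fun x =>
    inv_mul_eq_of_eq_mul x.2.1.symm
  rw [← Fintype.card_subtype, ← Nat.card_eq_fintype_card]
  exact Nat.card_congr
    { toFun := fun x => ⟨x.1.1, by rw [h]; exact x.2.2⟩
      invFun := fun u => ⟨(u.1, u.1⁻¹ * c), mul_inv_cancel_left _ _, u.2⟩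
      left_inv := fun x => Subtype.ext (Prod.ext rfl (h x))
      right_inv := fun u => rfl }

theorem catalan_eq_card (hk : 1 ≤ k) : catalan k = (Finset.univ.filter fun u : Perm (Fin k) =>
    cycleCount u + cycleCount (u⁻¹ * finRotate k) = k + 1).card := by
  have : Nonempty (Fin k) := ⟨⟨0, hk⟩⟩
  have h := sum_narayana hk
  rw [Finset.sum_congr rfl fun i hi => narayana_eq_card hi] at h
  rw [Finset.card_eq_sum_card_fiberwise (f := cycleCount) (t := Finset.Icc 1 k)]
  · have h' : catalan k = ∑ i ∈ Finset.Icc 1 k, (Finset.univ.filter fun u : Perm (Fin k) =>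
      cycleCount u = i ∧ cycleCount (u⁻¹ * finRotate k) = k + 1 - i).card := by
      exact_mod_cast h.symm
    rw [h']
    refine Finset.sum_congr rfl fun i hi => ?_
    rw [Finset.mem_Icc] at hi
    congr 1
    ext u
    simp only [Finset.mem_filter, Finset.mem_univ, true_and]
    omega
  · intro u hu
    have h1 := cycleCount_pos u
    have h2 := cycleCount_pos (u⁻¹ * finRotate k)
    simp only [Finset.coe_filter, Finset.mem_univ, true_and, Set.mem_ofPred_eq] at hu
    rw [Finset.mem_coe, Finset.mem_Icc]
    omega

end CharacterPolynomial

end RectangularCharacters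

end

theorem mainTheorem5 (k : ℕ) (hk : 1 ≤ k) :
    (∃! F : MvPolynomial (Fin 2) ℚ, RectangularCharacters.RepresentsNormalizedChar k F) ∧
    (∀ F : MvPolynomial (Fin 2) ℚ, RectangularCharacters.RepresentsNormalizedChar k F →
      (-1) ^ k * MvPolynomial.aeval ![MvPolynomial.X 0, -MvPolynomial.X 1]
          (RectangularCharacters.leadingTerms k F) =
        ∑ i ∈ Finset.Icc 1 k, MvPolynomial.C (RectangularCharacters.narayana k i) *
          (MvPolynomial.X 0 : MvPolynomial (Fin 2) ℚ) ^ (k + 1 - i) * MvPolynomial.X 1 ^ i) ∧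
    (∀ i ∈ Finset.Icc 1 k,
      RectangularCharacters.narayana k i =
        (Fintype.card {uv : Equiv.Perm (Fin k) × Equiv.Perm (Fin k) //
          uv.1 * uv.2 = finRotate k ∧ RectangularCharacters.numCycles uv.1 = i ∧
            RectangularCharacters.numCycles uv.2 = k + 1 - i} : ℚ)) ∧
    ∑ i ∈ Finset.Icc 1 k, RectangularCharacters.narayana k i = (catalan k : ℚ) ∧
    catalan k =
      Fintype.card {uv : Equiv.Perm (Fin k) × Equiv.Perm (Fin k) //
        uv.1 * uv.2 = finRotate k ∧
          RectangularCharacters.numCycles uv.1 + RectangularCharacters.numCycles uv.2 = k + 1} := by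
  open RectangularCharacters in
  refine ⟨⟨characterPoly k, representsNormalizedChar_characterPoly hk,
    fun F hF => hF.unique hk (representsNormalizedChar_characterPoly hk)⟩,
    fun F hF => ?_, fun i hi => ?_, sum_narayana hk, ?_⟩
  · rw [hF.unique hk (representsNormalizedChar_characterPoly hk),
      aeval_leadingTerms_characterPoly hk]
  · rw [narayana_eq_card hi, ← Nat.card_eq_fintype_card, card_factorizations _
      fun u v => numCycles u = i ∧ numCycles v = k + 1 - i]
    simp only [numCycles_eq_cycleCount]
  · rw [catalan_eq_card hk, ← Nat.card_eq_fintype_card, card_factorizations _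
      fun u v => numCycles u + numCycles v = k + 1]
    simp only [numCycles_eq_cycleCount]
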